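/- All graphs are finite and simple; $v(G)$ denotes the number of vertices of $G$, and $\hom(F,G)$ the number of graph homomorphisms from $F$ to $G$. The chromatic polynomial of $G$ is $P(G,x)=\sum_{k=0}^{v(G)}\mathrm{ip}(G,k)\,x(x-1)\cdots(x-k+1)$, where $\mathrm{ip}(G,k)$ is the number of partitions of the vertex set of $G$ into $k$ non-empty independent sets. Let $\mu_G$ be the uniform probability measure on the multiset of complex roots of $P(G,\cdot)$ (roots counted with multiplicity), and let $\nu_G$ be the rescaled measure $\nu_G(X)=\mu_G(v(G)X)$, i.e. the image of $\mu_G$ under $z\mapsto z/v(G)$ (for the graph without vertices, both are the zero measure). **Theorem.** Let $(G_n)_n$ be a sequence of graphs with $v(G_n)\to\infty$ that converges in the dense model, i.e. for every graph $F$ the sequence $\hom(F,G_n)/v(G_n)^{v(F)}$ converges. Let $f$ be a function that is holomorphic on the open disk $B(0,8)=\{z\in\mathbb{C}:|z|<8\}$. Then every $\nu_{G_n}$ is concentrated on $B(0,8)$ and $f$ is $\nu_{G_n}$-integrable, so that $\int f\,d\nu_{G_n}$ is well defined, and the sequence $\int f(z)\,d\nu_{G_n}(z)$ converges. -/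

import Mathlib

open Filter Topology MeasureTheory Polynomial

noncomputable section

namespace ChromaticLimits

/-- `ip(G, k)`: the number of partitions of the vertex set into `k` non-empty independent sets.
(`Setoid.IsPartition` includes that the empty set is not a part.) -/
def indepPartitions {V : Type*} (G : SimpleGraph V) (k : ℕ) : ℕ :=
  Set.ncard {P : Set (Set V) |
    Setoid.IsPartition P ∧ (∀ s ∈ P, G.IsIndepSet s) ∧ P.ncard = k}

/-- The chromatic polynomial `P(G, x) = ∑_{k = 0}^{v(G)} ip(G, k) x (x - 1) ⋯ (x - k + 1)`
of a finite graph, as a polynomial over `ℂ`. -/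
def chromaticPolynomial {V : Type*} (G : SimpleGraph V) : ℂ[X] :=
  ∑ k ∈ Finset.range (Nat.card V + 1), (indepPartitions G k : ℂ[X]) * descPochhammer ℂ k

/-- The chromatic measure `μ_G`: the uniform probability measure on the multiset of the complex
roots of the chromatic polynomial (every root is counted with its multiplicity).
It is the zero measure for the graph without vertices, which has no chromatic roots. -/
def chromaticMeasure {V : Type*} (G : SimpleGraph V) : Measure ℂ :=
  ((Multiset.card (chromaticPolynomial G).roots : ℕ) : ENNReal)⁻¹ •
    ((chromaticPolynomial G).roots.map Measure.dirac).sum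

/-- The rescaled chromatic measure `ν_G(X) = μ_G(v(G) X)`: the image of `μ_G` under
`z ↦ z / v(G)`. -/
def scaledChromaticMeasure {V : Type*} (G : SimpleGraph V) : Measure ℂ :=
  (chromaticMeasure G).map (fun z : ℂ => z / (Nat.card V : ℂ))

/-- `hom(F, G)`: the number of graph homomorphisms from `F` to `G`. -/
def homCount {U V : Type*} (F : SimpleGraph U) (G : SimpleGraph V) : ℕ :=
  Nat.card (F →g G)

/-- Convergence in the dense model: for every finite graph `F`, the sequence
`hom(F, G_n) / v(G_n) ^ v(F)` converges. -/
def DenseConvergent {V : ℕ → Type*} (G : ∀ n, SimpleGraph (V n)) : Prop :=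
  ∀ (m : ℕ) (F : SimpleGraph (Fin m)),
    ∃ t : ℝ, Tendsto (fun n => (homCount F (G n) : ℝ) / (Nat.card (V n) : ℝ) ^ m) atTop (𝓝 t)

end ChromaticLimits

end

/-! It suffices to confine the rescaled roots to a disk of radius less than 8 and to show that every
moment `∫ z ^ k` converges; Taylor expansion of `f` at 0 and dominated convergence do the rest. Both
facts come from one recursion, `chromaticPolynomial_insert`. The graph `G[S]` keeps the vertices
outside `S` as isolated points, and `X * P(G[S ∪ v])` equals `X * P(G[S])` minus one term for each
neighbour `u ∈ S` of `v`, the chromatic polynomial of a graph that differs from `G[S]` only in edges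
at `u`.

Roots: both graphs agree on `S \ u`. Comparing them there, induction on `S` shows that for `|z| ≥
6n` adding a vertex changes the value at `z` by at most half its modulus, so the value never
vanishes (`eval_restrict_ne_zero`).

Moments: for reversed polynomials the same comparison gives a recursion for the ratio of `G[S ∪ v]`
to `G[S \ v]`, whose coefficient of `X ^ i` is therefore a set function of degree at most `i`
(`coeffDegLE_vertexRatio`). Logarithmic derivatives generate the power sums of the roots, so the
`k`-th one, `k ≥ 1`, has degree at most `k + 1`. By Möbius inversion it is a fixed linear
combination of induced subgraph counts on at most `k + 1` vertices. The `k`-th moment is this power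
sum over `n ^ (k + 1)`, exactly the scale on which dense convergence controls such counts. -/

noncomputable section

namespace ChromaticLimits

/-! ### The chromatic polynomial counts proper colourings -/

/-- A map `φ : V → Fin q` which separates adjacent vertices. -/
def IsProper {V : Type*} (G : SimpleGraph V) {q : ℕ} (φ : V → Fin q) : Prop :=
  ∀ a b, G.Adj a b → φ a ≠ φ b

/-- The number of proper colourings of `G` with `q` colours. -/
def colorCount {V : Type*} (G : SimpleGraph V) (q : ℕ) : ℕ :=
  Nat.card {φ : V → Fin q // IsProper G φ}

/-- Equivalence relations all of whose classes are independent. -/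
def IndepSetoid {V : Type*} (G : SimpleGraph V) : Type _ :=
  {r : Setoid V // ∀ a b, r a b → ¬ G.Adj a b}

instance {V : Type*} [Finite V] (G : SimpleGraph V) : Finite (IndepSetoid G) :=
  Finite.of_injective (fun r : IndepSetoid G => fun a b => r.1 a b) (by
    intro r s h
    apply Subtype.ext
    ext a b
    exact iff_of_eq (congrFun (congrFun h a) b))

/-- The proper colouring given by an injective colouring of the classes. -/
def coloringOfSetoid {V : Type*} (G : SimpleGraph V) (q : ℕ)
    (x : Σ r : IndepSetoid G, (Quotient r.1 ↪ Fin q)) : {φ : V → Fin q // IsProper G φ} :=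
  ⟨fun a => x.2 (Quotient.mk x.1.1 a), fun a b hab h =>
    x.1.2 a b (Quotient.exact (x.2.injective h)) hab⟩

/-- A colouring is recovered from its kernel and the induced injection on the classes. -/
lemma coloringOfSetoid_bijective {V : Type*} (G : SimpleGraph V) (q : ℕ) :
    Function.Bijective (coloringOfSetoid G q) := by
  constructor
  · rintro ⟨⟨r, hr⟩, e⟩ ⟨⟨s, hs⟩, e'⟩ h
    have h' : ∀ a, e (Quotient.mk r a) = e' (Quotient.mk s a) :=
      fun a => congrFun (congrArg Subtype.val h) a
    have hrs : r = s := by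
      ext a b
      constructor
      · intro hab
        apply Quotient.exact (s := s)
        apply e'.injective
        rw [← h' a, ← h' b, Quotient.sound (s := r) hab]
      · intro hab
        apply Quotient.exact (s := r)
        apply e.injective
        rw [h' a, h' b, Quotient.sound (s := s) hab]
    subst hrs
    have : e = e' := by
      ext x
      induction x using Quotient.inductionOn with
      | h a => rw [h' a]
    rw [this]
  · rintro ⟨φ, hφ⟩
    refine ⟨⟨⟨Setoid.ker φ, fun a b hab hG => hφ a b hG hab⟩,
      ⟨Setoid.kerLift φ, Setoid.kerLift_injective φ⟩⟩, ?_⟩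
    apply Subtype.ext
    rfl

lemma colorCount_eq_sum {V : Type*} [Finite V] (G : SimpleGraph V) (q : ℕ)
    [Fintype (IndepSetoid G)] :
    colorCount G q = ∑ r : IndepSetoid G, q.descFactorial (Nat.card (Quotient r.1)) := by
  classical
  rw [colorCount, ← Nat.card_congr (Equiv.ofBijective _ (coloringOfSetoid_bijective G q)),
    Nat.card_sigma]
  refine Finset.sum_congr rfl fun r _ => ?_
  have := Fintype.ofFinite (Quotient r.1)
  rw [Nat.card_eq_fintype_card, Fintype.card_embedding_eq, Fintype.card_fin,
    Nat.card_eq_fintype_card]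

lemma indepPartitions_eq_card {V : Type*} [Finite V] (G : SimpleGraph V) (k : ℕ)
    [Fintype (IndepSetoid G)] :
    indepPartitions G k =
      (Finset.univ.filter fun r : IndepSetoid G => Nat.card (Quotient r.1) = k).card := by
  classical
  rw [indepPartitions, ← Set.ncard_coe_finset,
    ← Set.ncard_image_of_injective (f := fun r : IndepSetoid G => r.1.classes)
      _ (fun r s h => Subtype.ext (Setoid.classes_inj.2 h))]
  congr 1
  ext P
  simp only [Set.mem_ofPred_eq, Finset.coe_filter, Finset.mem_univ, true_and, Set.mem_image]
  constructor
  · rintro ⟨hP, hI, hk⟩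
    have hcl := Setoid.classes_mkClasses P hP
    refine ⟨⟨Setoid.mkClasses P hP.2, ?_⟩, ?_, hcl⟩
    · intro a b hab hG
      obtain ⟨c, hc, ha, hb⟩ := (Setoid.rel_iff_exists_classes _).1 hab
      rw [hcl] at hc
      exact hI c hc ha hb hG.ne hG
    · rw [Nat.card_congr (Setoid.quotientEquivClasses _), hcl]
      exact hk
  · rintro ⟨⟨r, hr⟩, hk, rfl⟩
    refine ⟨Setoid.isPartition_classes r, ?_, ?_⟩
    · rintro s ⟨y, rfl⟩ a ha b hb _
      exact hr a b (r.trans ha (r.symm hb))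
    · rw [← hk, Nat.card_congr (Setoid.quotientEquivClasses r)]
      rfl

/-- Colourings are grouped by the number of colours used. Through this lemma, polynomial identities
reduce to counting. -/
lemma eval_chromaticPolynomial {V : Type*} [Finite V] (G : SimpleGraph V) (q : ℕ) :
    (chromaticPolynomial G).eval (q : ℂ) = colorCount G q := by
  classical
  have := Fintype.ofFinite (IndepSetoid G)
  have hmaps : ∀ r ∈ (Finset.univ : Finset (IndepSetoid G)),
      Nat.card (Quotient r.1) ∈ Finset.range (Nat.card V + 1) := fun r _ =>
    Finset.mem_range.2 (Nat.lt_succ_of_le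
      (Nat.card_le_card_of_surjective _ (Quotient.mk_surjective (s := r.1))))
  rw [colorCount_eq_sum, ← Finset.sum_fiberwise_of_maps_to hmaps, chromaticPolynomial,
    eval_finsetSum, Nat.cast_sum]
  refine Finset.sum_congr rfl fun k _ => ?_
  rw [Finset.sum_congr rfl fun r hr => by rw [(Finset.mem_filter.1 hr).2], Finset.sum_const,
    eval_mul, eval_natCast, descPochhammer_eval_eq_descFactorial, indepPartitions_eq_card,
    smul_eq_mul, Nat.cast_mul]

/-- Two complex polynomials agreeing at the positive integers are equal. -/
lemma polynomial_eq_of_eval_nat {p r : ℂ[X]}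
    (h : ∀ q : ℕ, 0 < q → p.eval (q : ℂ) = r.eval (q : ℂ)) : p = r := by
  apply Polynomial.eq_of_infinite_eval_eq
  refine Set.Infinite.mono (s := Set.range fun q : ℕ => ((q + 1 : ℕ) : ℂ)) ?_ ?_
  · rintro _ ⟨q, rfl⟩
    exact h (q + 1) q.succ_pos
  · exact Set.infinite_range_of_injective fun a b hab => by
      simpa using hab

/-! ### The one-vertex recursion -/

/-- The graph obtained from `G` by keeping only the edges inside `S`. -/
def restrict {V : Type*} (G : SimpleGraph V) (S : Finset V) : SimpleGraph V where
  Adj a b := G.Adj a b ∧ a ∈ S ∧ b ∈ S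
  symm := ⟨fun _ _ h => ⟨h.1.symm, h.2.2, h.2.1⟩⟩
  loopless := ⟨fun _ h => h.1.ne rfl⟩

/-- The graph obtained from `G` by joining `u` to all the neighbours of `v` below `u`. -/
def joinBelow {V : Type*} [LinearOrder V] (G : SimpleGraph V) (v u : V) : SimpleGraph V where
  Adj a b := G.Adj a b ∨ (a = u ∧ G.Adj v b ∧ b < u) ∨ (b = u ∧ G.Adj v a ∧ a < u)
  symm := ⟨fun _ _ h => by
    rcases h with h | h | h
    · exact Or.inl h.symm
    · exact Or.inr (Or.inr h)
    · exact Or.inr (Or.inl h)⟩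
  loopless := ⟨fun a h => by
    rcases h with h | ⟨rfl, _, h⟩ | ⟨rfl, _, h⟩
    · exact h.ne rfl
    · exact lt_irrefl _ h
    · exact lt_irrefl _ h⟩

/-- All new edges are at `u`. This is what makes the two graphs comparable, both for the zero-free
region and for the power series. -/
lemma restrict_joinBelow_erase {V : Type*} [LinearOrder V] (G : SimpleGraph V) (v u : V)
    (S : Finset V) : restrict (joinBelow G v u) (S.erase u) = restrict G (S.erase u) := by
  ext a b
  simp only [restrict, joinBelow, Finset.mem_erase]
  constructor
  · rintro ⟨h | h | h, ha, hb⟩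
    · exact ⟨h, ha, hb⟩
    · exact absurd h.1 ha.1
    · exact absurd h.1 hb.1
  · rintro ⟨h, ha, hb⟩
    exact ⟨Or.inl h, ha, hb⟩

lemma restrict_empty {V : Type*} (G : SimpleGraph V) : restrict G ∅ = ⊥ := by
  ext a b
  simp [restrict]

lemma restrict_univ {V : Type*} [Fintype V] (G : SimpleGraph V) :
    restrict G Finset.univ = G := by
  ext a b
  simp [restrict]

lemma isProper_joinBelow_iff {V : Type*} [LinearOrder V] (G : SimpleGraph V) {v u : V}
    {S : Finset V} (hu : u ∈ S) {q : ℕ} (φ : V → Fin q) (hφ : φ u = φ v) :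
    IsProper (restrict (joinBelow G v u) S) φ ↔
      IsProper (restrict G S) φ ∧ ∀ w ∈ S, G.Adj v w → w < u → φ w ≠ φ v := by
  constructor
  · intro h
    refine ⟨fun a b hab => h a b ⟨Or.inl hab.1, hab.2⟩, fun w hw hvw hwu => ?_⟩
    rw [← hφ]
    exact h w u ⟨Or.inr (Or.inr ⟨rfl, hvw, hwu⟩), hw, hu⟩
  · rintro ⟨h1, h2⟩ a b ⟨h | ⟨rfl, h, hb⟩ | ⟨rfl, h, ha⟩, haS, hbS⟩
    · exact h1 a b ⟨h, haS, hbS⟩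
    · rw [hφ]
      exact (h2 b hbS h hb).symm
    · rw [hφ]
      exact h2 a haS h ha

/-- If `v` is isolated, a fraction `1 / q` of the proper colourings gives `v` the colour
of `u`. -/
lemma colorCount_eq_mul_card {V : Type*} [DecidableEq V] [Finite V] (H : SimpleGraph V) {u v : V}
    (huv : u ≠ v) (hv : ∀ b, ¬ H.Adj v b) (q : ℕ) :
    colorCount H q = q * Nat.card {φ : V → Fin q // IsProper H φ ∧ φ u = φ v} := by
  have hupd : ∀ (φ : V → Fin q) (c : Fin q), IsProper H φ →
      IsProper H (Function.update φ v c) := by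
    intro φ c h a b hab
    have ha : a ≠ v := fun e => hv b (e ▸ hab)
    have hb : b ≠ v := fun e => hv a (e ▸ hab.symm)
    rw [Function.update_of_ne ha, Function.update_of_ne hb]
    exact h a b hab
  -- Recolouring the isolated vertex `v` is free: record its colour, then give it that of `u`.
  have e : {φ : V → Fin q // IsProper H φ} ≃
      Fin q × {φ : V → Fin q // IsProper H φ ∧ φ u = φ v} :=
    { toFun := fun φ => (φ.1 v, ⟨Function.update φ.1 v (φ.1 u), hupd _ _ φ.2, by
        rw [Function.update_of_ne huv, Function.update_self]⟩)
      invFun := fun x => ⟨Function.update x.2.1 v x.1, hupd _ _ x.2.2.1⟩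
      left_inv := fun φ => Subtype.ext (by simp)
      right_inv := fun x => by
        obtain ⟨c, φ, hφ, h⟩ := x
        refine Prod.ext (by simp) (Subtype.ext ?_)
        simp [Function.update_of_ne huv, h] }
  rw [colorCount, Nat.card_congr e, Nat.card_prod, Nat.card_eq_fintype_card, Fintype.card_fin]

open Classical in
-- In `G[S]` the vertex `v` is isolated. A colouring of `G[S]` that fails on `G[S ∪ v]` is
-- classified by the least neighbour `u ∈ S` of `v` with the colour of `v`; minimality of `u` is
-- properness for the edges added by `joinBelow`. The factor `q` pays for the condition `φ u = φ v`.
lemma colorCount_insert {V : Type*} [LinearOrder V] [Fintype V] (G : SimpleGraph V) {v : V}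
    {S : Finset V} (hv : v ∉ S) (q : ℕ) :
    q * colorCount (restrict G S) q = q * colorCount (restrict G (insert v S)) q +
      ∑ u ∈ S with G.Adj v u, colorCount (restrict (joinBelow G v u) S) q := by
  set A : Finset (V → Fin q) := Finset.univ.filter (IsProper (restrict G S)) with hA
  set B : Finset (V → Fin q) := Finset.univ.filter (IsProper (restrict G (insert v S))) with hB
  set C : V → Finset (V → Fin q) := fun u => Finset.univ.filter
    fun φ => IsProper (restrict (joinBelow G v u) S) φ ∧ φ u = φ v with hC
  have hcount : ∀ u ∈ S.filter (G.Adj v),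
      colorCount (restrict (joinBelow G v u) S) q = q * (C u).card := by
    intro u hu
    rw [colorCount_eq_mul_card (u := u) (v := v) _ (fun h => hv (h ▸ (Finset.mem_filter.1 hu).1))
      (fun b hb => hv (And.left (And.right hb))), Nat.card_eq_fintype_card, Fintype.card_subtype]
  have hmemC : ∀ u ∈ S.filter (G.Adj v), ∀ φ, φ ∈ C u ↔ φ u = φ v ∧ IsProper (restrict G S) φ ∧
      ∀ w ∈ S, G.Adj v w → w < u → φ w ≠ φ v := by
    intro u hu φ
    simp only [hC, Finset.mem_filter, Finset.mem_univ, true_and]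
    rw [and_comm]
    exact and_congr_right fun h => isProper_joinBelow_iff G (Finset.mem_filter.1 hu).1 φ h
  have hunion : A = B ∪ (S.filter (G.Adj v)).biUnion C := by
    ext φ
    simp only [hA, hB, Finset.mem_union, Finset.mem_filter, Finset.mem_univ, true_and,
      Finset.mem_biUnion]
    constructor
    · intro h
      by_cases hne : (S.filter fun w => G.Adj v w ∧ φ w = φ v).Nonempty
      · right
        have hmin := Finset.min'_mem _ hne
        set u := Finset.min' _ hne with hu
        rw [Finset.mem_filter] at hmin
        refine ⟨u, ⟨hmin.1, hmin.2.1⟩, ?_⟩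
        rw [hmemC u (Finset.mem_filter.2 ⟨hmin.1, hmin.2.1⟩)]
        refine ⟨hmin.2.2, h, fun w hw hvw hwu hwv => ?_⟩
        exact absurd (Finset.min'_le _ w (Finset.mem_filter.2 ⟨hw, hvw, hwv⟩)) (not_le.2 hwu)
      · left
        rw [Finset.not_nonempty_iff_eq_empty, Finset.filter_eq_empty_iff] at hne
        rintro a b ⟨hab, ha, hb⟩
        rw [Finset.mem_insert] at ha hb
        rcases ha with rfl | ha
        · rcases hb with rfl | hb
          · exact absurd rfl hab.ne
          · exact fun e => hne hb ⟨hab, e.symm⟩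
        · rcases hb with rfl | hb
          · exact fun e => hne ha ⟨hab.symm, e⟩
          · exact h a b ⟨hab, ha, hb⟩
    · rintro (h | ⟨u, hu, h⟩)
      · rintro a b ⟨hab, ha, hb⟩
        exact h a b ⟨hab, Finset.mem_insert_of_mem ha, Finset.mem_insert_of_mem hb⟩
      · exact ((hmemC u (Finset.mem_filter.2 hu) φ).1 h).2.1
  have hdisj : Disjoint B ((S.filter (G.Adj v)).biUnion C) := by
    rw [Finset.disjoint_biUnion_right]
    intro u hu
    rw [Finset.disjoint_left]
    intro φ hφ hφ'
    have h1 := ((hmemC u hu φ).1 hφ').1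
    rw [Finset.mem_filter] at hu
    exact (Finset.mem_filter.1 hφ).2 v u
      ⟨hu.2, Finset.mem_insert_self _ _, Finset.mem_insert_of_mem hu.1⟩ h1.symm
  have hpair : Set.PairwiseDisjoint (↑(S.filter (G.Adj v)) : Set V) C := by
    intro u hu w hw huw
    rw [Function.onFun, Finset.disjoint_left]
    intro φ h1 h2
    have h1 := (hmemC u hu φ).1 h1
    have h2 := (hmemC w hw φ).1 h2
    have hu := Finset.mem_filter.1 hu
    have hw := Finset.mem_filter.1 hw
    rcases lt_or_gt_of_ne huw with h | h
    · exact h2.2.2 u hu.1 hu.2 h h1.1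
    · exact h1.2.2 w hw.1 hw.2 h h2.1
  have hcardA : colorCount (restrict G S) q = A.card := by
    rw [colorCount, Nat.card_eq_fintype_card, Fintype.card_subtype]
  have hcardB : colorCount (restrict G (insert v S)) q = B.card := by
    rw [colorCount, Nat.card_eq_fintype_card, Fintype.card_subtype]
  rw [Finset.sum_congr rfl hcount, hcardA, hcardB, hunion, Finset.card_union_of_disjoint hdisj,
    Finset.card_biUnion hpair, mul_add, Finset.mul_sum]

open Classical in
lemma chromaticPolynomial_insert {V : Type*} [LinearOrder V] [Fintype V] (G : SimpleGraph V)
    {v : V} {S : Finset V} (hv : v ∉ S) :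
    X * chromaticPolynomial (restrict G (insert v S)) = X * chromaticPolynomial (restrict G S) -
      ∑ u ∈ S with G.Adj v u, chromaticPolynomial (restrict (joinBelow G v u) S) := by
  refine polynomial_eq_of_eval_nat fun q _ => ?_
  simp only [eval_mul, eval_X, eval_sub, eval_finsetSum, eval_chromaticPolynomial]
  rw [eq_sub_iff_add_eq]
  exact_mod_cast (colorCount_insert G hv q).symm

lemma chromaticPolynomial_bot {V : Type*} [Fintype V] :
    chromaticPolynomial (⊥ : SimpleGraph V) = X ^ Fintype.card V := by
  classical
  refine polynomial_eq_of_eval_nat fun q _ => ?_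
  have h : ∀ φ : V → Fin q, IsProper ⊥ φ := fun φ a b hab => absurd hab (by simp)
  rw [eval_chromaticPolynomial, colorCount, Nat.card_congr (Equiv.subtypeUnivEquiv h)]
  simp

/-- In the recursion the correction terms have degree `n`, below the degree `n + 1` of the main
term. -/
lemma chromaticPolynomial_restrict_monic {V : Type*} [LinearOrder V] [Fintype V]
    (S : Finset V) : ∀ G : SimpleGraph V, (chromaticPolynomial (restrict G S)).Monic ∧
      (chromaticPolynomial (restrict G S)).natDegree = Fintype.card V := by
  classical
  induction S using Finset.induction_on with
  | empty =>
    intro G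
    rw [restrict_empty, chromaticPolynomial_bot]
    exact ⟨monic_X_pow _, natDegree_X_pow _⟩
  | insert v S hv ih =>
    intro G
    have hrec := chromaticPolynomial_insert G hv
    have hm : (X * chromaticPolynomial (restrict G S)).Monic := monic_X.mul (ih G).1
    have hd : (X * chromaticPolynomial (restrict G S)).natDegree = Fintype.card V + 1 := by
      rw [monic_X.natDegree_mul (ih G).1, natDegree_X, (ih G).2, add_comm]
    have hlt : (∑ u ∈ S with G.Adj v u,
        chromaticPolynomial (restrict (joinBelow G v u) S)).degree <
        (X * chromaticPolynomial (restrict G S)).degree := by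
      rw [degree_eq_natDegree hm.ne_zero, hd]
      refine lt_of_le_of_lt (degree_sum_le _ _) ?_
      rw [Finset.sup_lt_iff (WithBot.bot_lt_coe _)]
      intro u _
      rw [degree_eq_natDegree (ih _).1.ne_zero, (ih _).2]
      exact_mod_cast Nat.lt_succ_self _
    have hm' := hm.sub_of_left hlt
    have hd' := natDegree_eq_of_degree_eq (degree_sub_eq_left_of_degree_lt hlt)
    rw [← hrec] at hm' hd'
    have hmon := (monic_X (R := ℂ)).of_mul_monic_left hm'
    refine ⟨hmon, ?_⟩
    rw [hd, monic_X.natDegree_mul hmon, natDegree_X] at hd'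
    omega

lemma exists_linearOrder (V : Type*) [Finite V] : Nonempty (LinearOrder V) :=
  ⟨LinearOrder.lift' (Finite.equivFin V) (Finite.equivFin V).injective⟩

lemma chromaticPolynomial_monic {V : Type*} [Fintype V] (G : SimpleGraph V) :
    (chromaticPolynomial G).Monic := by
  obtain ⟨_⟩ := exists_linearOrder V
  simpa [restrict_univ] using (chromaticPolynomial_restrict_monic Finset.univ G).1

lemma natDegree_chromaticPolynomial {V : Type*} [Fintype V] (G : SimpleGraph V) :
    (chromaticPolynomial G).natDegree = Fintype.card V := by
  obtain ⟨_⟩ := exists_linearOrder V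
  simpa [restrict_univ] using (chromaticPolynomial_restrict_monic Finset.univ G).2

/-! ### Bound on the chromatic roots -/

/-- Zero-freeness of the chromatic polynomial outside the disk of radius `6 N`, together with an
estimate of the effect of adding one vertex. -/
lemma eval_restrict_ne_zero {V : Type*} [LinearOrder V] [Fintype V] {N : ℝ} (hN : 0 < N)
    (hVN : (Fintype.card V : ℝ) ≤ N) {z : ℂ} (hz : 6 * N ≤ ‖z‖) (S : Finset V) :
    (∀ G : SimpleGraph V, (chromaticPolynomial (restrict G S)).eval z ≠ 0) ∧
    ∀ (G : SimpleGraph V) (v : V), v ∉ S →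
      ‖(chromaticPolynomial (restrict G (insert v S))).eval z -
        (chromaticPolynomial (restrict G S)).eval z‖ ≤
      1 / 2 * ‖(chromaticPolynomial (restrict G S)).eval z‖ := by
  classical
  have hz0 : 0 < ‖z‖ := lt_of_lt_of_le (by linarith) hz
  induction S using Finset.strongInduction with
  | H S ih =>
    set P : SimpleGraph V → Finset V → ℂ :=
      fun G S => (chromaticPolynomial (restrict G S)).eval z with hP
    have hpart1 : ∀ G, P G S ≠ 0 := by
      intro G
      rcases S.eq_empty_or_nonempty with rfl | ⟨v, hv⟩
      · simp only [hP, restrict_empty, chromaticPolynomial_bot, eval_pow, eval_X]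
        exact pow_ne_zero _ (norm_pos_iff.1 hz0)
      · obtain ⟨h1, h2⟩ := ih _ (Finset.erase_ssubset hv)
        have h := h2 G v (Finset.notMem_erase v S)
        rw [Finset.insert_erase hv] at h
        have hpos := norm_pos_iff.2 (h1 G)
        intro h0
        have h0' : (chromaticPolynomial (restrict G S)).eval z = 0 := h0
        rw [h0', zero_sub, norm_neg] at h
        linarith
    refine ⟨hpart1, fun G v hv => ?_⟩
    -- Both values lie within a factor between `1/2` and `3/2` of their common value on `S \ u`;
    -- hence `3 = (3/2) / (1/2)`.
    have hratio : ∀ u ∈ S, ‖P (joinBelow G v u) S‖ ≤ 3 * ‖P G S‖ := by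
      intro u hu
      obtain ⟨-, h2⟩ := ih _ (Finset.erase_ssubset hu)
      have ha := h2 G u (Finset.notMem_erase u S)
      have hb := h2 (joinBelow G v u) u (Finset.notMem_erase u S)
      rw [restrict_joinBelow_erase, Finset.insert_erase hu] at hb
      rw [Finset.insert_erase hu] at ha
      have ha' := norm_sub_norm_le (P G (S.erase u)) (P G S)
      have hb' := norm_sub_norm_le (P (joinBelow G v u) S) (P G (S.erase u))
      rw [norm_sub_rev] at ha'
      simp only [hP] at ha' hb' ⊢
      linarith
    have hrec := congrArg (eval z) (chromaticPolynomial_insert G hv)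
    simp only [eval_mul, eval_X, eval_sub, eval_finsetSum] at hrec
    have hsum : ‖∑ u ∈ S with G.Adj v u, P (joinBelow G v u) S‖ ≤ N * (3 * ‖P G S‖) := by
      refine (norm_sum_le _ _).trans ?_
      refine (Finset.sum_le_sum fun u hu => hratio u (Finset.mem_filter.1 hu).1).trans ?_
      rw [Finset.sum_const, nsmul_eq_mul]
      refine mul_le_mul_of_nonneg_right (le_trans ?_ hVN) (by positivity)
      exact_mod_cast Finset.card_le_univ _
    have hmul : ‖z‖ * ‖P G (insert v S) - P G S‖ ≤ N * (3 * ‖P G S‖) := by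
      rw [← norm_mul, mul_sub]
      have : z * P G (insert v S) - z * P G S =
          -∑ u ∈ S with G.Adj v u, P (joinBelow G v u) S := by
        simp only [hP]
        rw [hrec]
        ring
      rw [this, norm_neg]
      exact hsum
    -- The radius `6 N` is chosen so that `3 N ≤ ‖z‖ / 2`.
    have hle : N * (3 * ‖P G S‖) ≤ ‖z‖ * (1 / 2 * ‖P G S‖) := by
      nlinarith [norm_nonneg (P G S)]
    exact le_of_mul_le_mul_left (hmul.trans hle) hz0

/-- All chromatic roots of a graph with `n` vertices lie in the open disk of radius `6 n`. -/
lemma norm_lt_of_mem_roots {V : Type*} [Fintype V] (G : SimpleGraph V) {z : ℂ}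
    (hz : z ∈ (chromaticPolynomial G).roots) : ‖z‖ < 6 * Fintype.card V := by
  obtain ⟨_⟩ := exists_linearOrder V
  rw [mem_roots (chromaticPolynomial_monic G).ne_zero, IsRoot.def] at hz
  rcases (Fintype.card V).eq_zero_or_pos with h0 | hpos
  · have hdeg := natDegree_chromaticPolynomial G
    rw [h0] at hdeg
    rw [(chromaticPolynomial_monic G).natDegree_eq_zero.1 hdeg] at hz
    simp at hz
  · by_contra hle
    refine (eval_restrict_ne_zero (V := V) (N := Fintype.card V) (by exact_mod_cast hpos) le_rfl
      (not_lt.1 hle) Finset.univ).1 G ?_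
    rwa [restrict_univ]

lemma card_roots_chromaticPolynomial {V : Type*} [Fintype V] (G : SimpleGraph V) :
    (chromaticPolynomial G).roots.card = Fintype.card V := by
  rw [← natDegree_chromaticPolynomial G]
  exact splits_iff_card_roots.1 (IsAlgClosed.splits _)

/-! ### Set functions of bounded degree and Möbius inversion -/

section SetFunctions

variable {V : Type*} [DecidableEq V]

/-- The set function `S ↦ [D ⊆ S]`. -/
def subsetIndicator (D : Finset V) : Finset V → ℂ := fun S => if D ⊆ S then 1 else 0

/-- Set functions of degree at most `d`: the span of the functions `S ↦ [D ⊆ S]` with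
`|D| ≤ d`. -/
def degLE (V : Type*) [DecidableEq V] (d : ℕ) : Submodule ℂ (Finset V → ℂ) :=
  Submodule.span ℂ (subsetIndicator '' {D : Finset V | D.card ≤ d})

lemma subsetIndicator_mem_degLE {D : Finset V} {d : ℕ} (h : D.card ≤ d) :
    subsetIndicator D ∈ degLE V d :=
  Submodule.subset_span ⟨D, h, rfl⟩

lemma one_mem_degLE (d : ℕ) : (fun _ => 1 : Finset V → ℂ) ∈ degLE V d := by
  have h : (fun _ => 1 : Finset V → ℂ) = subsetIndicator ∅ := by
    funext S
    simp [subsetIndicator]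
  rw [h]
  exact subsetIndicator_mem_degLE (by simp)

/-- The product of the indicators of `D` and `E` is the indicator of `D ∪ E`. -/
lemma mul_mem_degLE {a b : ℕ} {f g : Finset V → ℂ} (hf : f ∈ degLE V a) (hg : g ∈ degLE V b) :
    (fun S => f S * g S) ∈ degLE V (a + b) := by
  have h := Submodule.mul_mem_mul hf hg
  rw [degLE, degLE, Submodule.span_mul_span] at h
  refine Submodule.span_mono ?_ h
  rintro _ ⟨_, ⟨D, hD, rfl⟩, _, ⟨E, hE, rfl⟩, rfl⟩
  refine ⟨D ∪ E, (Finset.card_union_le D E).trans (add_le_add hD hE), ?_⟩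
  funext S
  by_cases h1 : D ⊆ S <;> by_cases h2 : E ⊆ S <;>
    simp [subsetIndicator, Finset.union_subset_iff, h1, h2]

lemma erase_mem_degLE {d : ℕ} {f : Finset V → ℂ} (hf : f ∈ degLE V d) (v : V) :
    (fun S => f (S.erase v)) ∈ degLE V d := by
  induction hf using Submodule.span_induction with
  | mem f hf =>
    obtain ⟨D, hD, rfl⟩ := hf
    by_cases hv : v ∈ D
    · have h : (fun S : Finset V => subsetIndicator D (S.erase v)) = 0 := by
        funext S
        exact if_neg fun h => Finset.notMem_erase v S (h hv)
      rw [h]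
      exact Submodule.zero_mem _
    · have h : (fun S : Finset V => subsetIndicator D (S.erase v)) = subsetIndicator D := by
        funext S
        simp [subsetIndicator, Finset.subset_erase, hv]
      rw [h]
      exact subsetIndicator_mem_degLE hD
  | zero => exact Submodule.zero_mem _
  | add f g _ _ hf hg => exact Submodule.add_mem _ hf hg
  | smul c f _ hf => exact Submodule.smul_mem _ c hf

lemma sum_mem_degLE {ι : Type*} {d : ℕ} (s : Finset ι) {f : ι → Finset V → ℂ}
    (hf : ∀ i ∈ s, f i ∈ degLE V d) : (fun S => ∑ i ∈ s, f i S) ∈ degLE V d := by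
  have h := Submodule.sum_mem _ hf
  convert h using 1
  funext S
  rw [Finset.sum_apply]

/-- The Möbius transform of a set function. -/
def mobius (T : Finset V) (f : Finset V → ℂ) : ℂ :=
  ∑ S ∈ T.powerset, (-1) ^ (T.card + S.card) * f S

/-- The Möbius transform iterates discrete derivatives. Erasing `v` changes nothing on subsets of
`T`, but makes the difference independent of whether `v ∈ S`. -/
lemma mobius_insert {v : V} {T : Finset V} (hv : v ∉ T) (f : Finset V → ℂ) :
    mobius (insert v T) f = mobius T (fun S => f (insert v S) - f (S.erase v)) := by
  rw [mobius, mobius, Finset.sum_powerset_insert hv, ← Finset.sum_add_distrib]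
  refine Finset.sum_congr rfl fun S hS => ?_
  have hvS : v ∉ S := fun h => hv (Finset.mem_powerset.1 hS h)
  rw [Finset.card_insert_of_notMem hv, Finset.card_insert_of_notMem hvS,
    Finset.erase_eq_of_notMem hvS]
  ring

lemma sum_mobius (T : Finset V) : ∀ f : Finset V → ℂ, ∑ D ∈ T.powerset, mobius D f = f T := by
  induction T using Finset.induction_on with
  | empty =>
    intro f
    simp [mobius]
  | insert v T hv ih =>
    intro f
    have h : ∀ D ∈ T.powerset, mobius (insert v D) f =
        mobius D (fun S => f (insert v S) - f (S.erase v)) := fun D hD =>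
      mobius_insert (fun h => hv (Finset.mem_powerset.1 hD h)) f
    rw [Finset.sum_powerset_insert hv, Finset.sum_congr rfl h, ih, ih, Finset.erase_eq_of_notMem hv]
    ring

/-- A set larger than `D` has a point outside `D`, and the indicator of `D` is constant in that
direction. -/
lemma mobius_eq_zero {d : ℕ} {f : Finset V → ℂ} (hf : f ∈ degLE V d) {T : Finset V}
    (hT : d < T.card) : mobius T f = 0 := by
  induction hf using Submodule.span_induction with
  | mem f hf =>
    obtain ⟨D, hD, rfl⟩ := hf
    obtain ⟨w, hwT, hwD⟩ : ∃ w ∈ T, w ∉ D := Finset.exists_mem_notMem_of_card_lt_card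
      (lt_of_le_of_lt hD hT)
    rw [← Finset.insert_erase hwT, mobius_insert (Finset.notMem_erase w T)]
    refine Finset.sum_eq_zero fun S _ => ?_
    have h : D ⊆ insert w S ↔ D ⊆ S.erase w := by
      rw [Finset.subset_insert_iff_of_notMem hwD, Finset.subset_erase]
      simp [hwD]
    simp [subsetIndicator, h]
  | zero => simp [mobius]
  | add f g _ _ hf hg =>
    have h : mobius T (f + g) = mobius T f + mobius T g := by
      simp [mobius, mul_add, Finset.sum_add_distrib]
    rw [h, hf, hg, add_zero]
  | smul c f _ hf =>
    have h : mobius T (c • f) = c * mobius T f := by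
      simp [mobius, Finset.mul_sum, mul_left_comm]
    rw [h, hf, mul_zero]

/-- For a family of power series indexed by sets: for `i < j`, the coefficient of `X ^ i` is a
set function of degree at most `i`. -/
def CoeffDegLE (j : ℕ) (F : Finset V → PowerSeries ℂ) : Prop :=
  ∀ i < j, (fun S => PowerSeries.coeff i (F S)) ∈ degLE V i

lemma CoeffDegLE.mul {j : ℕ} {F G : Finset V → PowerSeries ℂ} (hF : CoeffDegLE j F)
    (hG : CoeffDegLE j G) : CoeffDegLE j (fun S => F S * G S) := by
  intro i hi
  simp only [PowerSeries.coeff_mul]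
  refine sum_mem_degLE _ fun x hx => ?_
  have hx := Finset.HasAntidiagonal.mem_antidiagonal.1 hx
  rw [← hx]
  exact mul_mem_degLE (hF _ (by omega)) (hG _ (by omega))

lemma CoeffDegLE.inv {j : ℕ} {F : Finset V → PowerSeries ℂ} (hF : CoeffDegLE j F)
    (h1 : ∀ S, PowerSeries.constantCoeff (F S) = 1) : CoeffDegLE j (fun S => (F S)⁻¹) := by
  intro i
  induction i using Nat.strong_induction_on with
  | _ i ih =>
    intro hi
    rcases Nat.eq_zero_or_pos i with rfl | hpos
    · have h : (fun S => PowerSeries.coeff 0 (F S)⁻¹) = fun _ => 1 := by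
        funext S
        rw [PowerSeries.coeff_zero_eq_constantCoeff_apply, PowerSeries.constantCoeff_inv, h1,
          inv_one]
      rw [h]
      exact one_mem_degLE 0
    · have h : (fun S => PowerSeries.coeff i (F S)⁻¹) = -fun S =>
          ∑ x ∈ Finset.HasAntidiagonal.antidiagonal i, if x.2 < i then
            PowerSeries.coeff x.1 (F S) * PowerSeries.coeff x.2 (F S)⁻¹ else 0 := by
        funext S
        rw [PowerSeries.coeff_inv, if_neg hpos.ne', h1, inv_one, Pi.neg_apply]
        ring
      rw [h]
      refine Submodule.neg_mem _ (sum_mem_degLE _ fun x hx => ?_)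
      have hx := Finset.HasAntidiagonal.mem_antidiagonal.1 hx
      by_cases hlt : x.2 < i
      · simp only [hlt, if_true]
        have hm := mul_mem_degLE (hF x.1 (by omega)) (ih x.2 hlt (by omega))
        rwa [hx] at hm
      · simp only [hlt, if_false]
        exact Submodule.zero_mem _

end SetFunctions

/-! ### Power sums of the roots have bounded degree -/

/-- The reversed chromatic polynomial of `G` restricted to `S`, as a power series. -/
def revSeries {V : Type*} (G : SimpleGraph V) (S : Finset V) : PowerSeries ℂ :=
  ((chromaticPolynomial (restrict G S)).reverse : ℂ[X])

lemma reflect_sum {ι : Type*} (N : ℕ) (s : Finset ι) (f : ι → ℂ[X]) :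
    reflect N (∑ i ∈ s, f i) = ∑ i ∈ s, reflect N (f i) :=
  map_sum (⟨⟨reflect N, reflect_zero⟩, fun p q => reflect_add p q N⟩ : ℂ[X] →+ ℂ[X]) f s

open Classical in
lemma revSeries_insert {V : Type*} [LinearOrder V] [Fintype V] (G : SimpleGraph V) {v : V}
    {S : Finset V} (hv : v ∉ S) :
    revSeries G (insert v S) = revSeries G S -
      PowerSeries.X * ∑ u ∈ S with G.Adj v u, revSeries (joinBelow G v u) S := by
  set n := Fintype.card V
  -- Reflecting at degree `n + 1` absorbs the `X` in the main terms and creates one in the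
  -- correction terms.
  have hX : ∀ G : SimpleGraph V, reflect (1 + n) (X * chromaticPolynomial G) =
      (chromaticPolynomial G).reverse := fun G => by
    rw [reflect_mul _ _ (natDegree_X_le) (natDegree_chromaticPolynomial G).le, reflect_one_X,
      one_mul, reverse, natDegree_chromaticPolynomial G]
  have h1 : ∀ G : SimpleGraph V, reflect (1 + n) (chromaticPolynomial G) =
      X * (chromaticPolynomial G).reverse := fun G => by
    have := reflect_mul (F := 1) (G := n) (1 : ℂ[X]) (chromaticPolynomial G) (by simp)
      (natDegree_chromaticPolynomial G).le
    rw [one_mul, reflect_one, pow_one] at this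
    rw [this, reverse, natDegree_chromaticPolynomial G]
  have hrec := congrArg (reflect (1 + n)) (chromaticPolynomial_insert G hv)
  rw [reflect_sub, hX, hX, reflect_sum, Finset.sum_congr rfl fun u _ => h1 _,
    ← Finset.mul_sum] at hrec
  simp only [revSeries, hrec, Polynomial.coe_sub, Polynomial.coe_mul, Polynomial.coe_X]
  congr 2
  exact map_sum (Polynomial.coeToPowerSeries.ringHom (R := ℂ)) _ _

lemma constantCoeff_revSeries {V : Type*} [Fintype V] (G : SimpleGraph V) (S : Finset V) :
    PowerSeries.constantCoeff (revSeries G S) = 1 := by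
  rw [revSeries, ← PowerSeries.coeff_zero_eq_constantCoeff_apply, Polynomial.coeff_coe,
    coeff_zero_reverse]
  exact chromaticPolynomial_monic _

/-- The effect of adding the vertex `v` on the reversed chromatic polynomial. -/
def vertexRatio {V : Type*} [DecidableEq V] (G : SimpleGraph V) (v : V) (S : Finset V) :
    PowerSeries ℂ :=
  revSeries G (insert v S) * (revSeries G (S.erase v))⁻¹

lemma constantCoeff_vertexRatio {V : Type*} [DecidableEq V] [Fintype V] (G : SimpleGraph V)
    (v : V) (S : Finset V) : PowerSeries.constantCoeff (vertexRatio G v S) = 1 := by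
  rw [vertexRatio, map_mul, PowerSeries.constantCoeff_inv, constantCoeff_revSeries,
    constantCoeff_revSeries, inv_one, mul_one]

lemma vertexRatio_mul {V : Type*} [DecidableEq V] [Fintype V] (G : SimpleGraph V)
    (v : V) (S : Finset V) :
    vertexRatio G v S * revSeries G (S.erase v) = revSeries G (insert v S) := by
  rw [vertexRatio, mul_assoc, PowerSeries.inv_mul_cancel, mul_one]
  rw [constantCoeff_revSeries]
  exact one_ne_zero

open Classical in
-- Divide the reversed recursion by the series of `G[S \ v]` and express each quotient through `S \
-- {u, v}`, where both graphs agree. The indicator of `u ∈ S` frees the range of summation from `S`.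
lemma vertexRatio_eq {V : Type*} [LinearOrder V] [Fintype V] (G : SimpleGraph V) (v : V)
    (S : Finset V) :
    vertexRatio G v S = 1 - PowerSeries.X * ∑ u with G.Adj v u,
      PowerSeries.C (subsetIndicator {u} S) *
        (vertexRatio (joinBelow G v u) u (S.erase v) * (vertexRatio G u (S.erase v))⁻¹) := by
  have hne : ∀ (G : SimpleGraph V) (S : Finset V),
      PowerSeries.constantCoeff (revSeries G S) ≠ 0 := fun G S => by
    rw [constantCoeff_revSeries]
    exact one_ne_zero
  have hterm : ∀ u ∈ S.erase v, revSeries (joinBelow G v u) (S.erase v) =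
      (vertexRatio (joinBelow G v u) u (S.erase v) * (vertexRatio G u (S.erase v))⁻¹) *
        revSeries G (S.erase v) := by
    intro u hu
    have h1 := vertexRatio_mul (joinBelow G v u) u (S.erase v)
    have h2 := vertexRatio_mul G u (S.erase v)
    have h3 : (vertexRatio G u (S.erase v))⁻¹ * vertexRatio G u (S.erase v) = 1 :=
      PowerSeries.inv_mul_cancel _ (by
        rw [constantCoeff_vertexRatio]
        exact one_ne_zero)
    rw [Finset.insert_eq_of_mem hu] at h1 h2
    rw [← h1, ← h2, mul_assoc, ← mul_assoc _ (vertexRatio G u (S.erase v)), h3, one_mul, revSeries,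
      restrict_joinBelow_erase, revSeries]
  have hins : insert v S = insert v (S.erase v) := by
    ext a
    by_cases h : a = v <;> simp [h]
  have hsum : ∑ u ∈ S.erase v with G.Adj v u, revSeries (joinBelow G v u) (S.erase v) =
      (∑ u with G.Adj v u, PowerSeries.C (subsetIndicator {u} S) *
        (vertexRatio (joinBelow G v u) u (S.erase v) * (vertexRatio G u (S.erase v))⁻¹)) *
        revSeries G (S.erase v) := by
    rw [Finset.sum_mul, Finset.sum_filter, Finset.sum_filter,
      ← Finset.sum_subset (Finset.subset_univ (S.erase v))]
    · refine Finset.sum_congr rfl fun u hu => ?_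
      have : subsetIndicator {u} S = 1 :=
        if_pos (Finset.singleton_subset_iff.2 (Finset.mem_of_mem_erase hu))
      rw [this, map_one, one_mul, ← hterm u hu]
    · intro u _ hu
      by_cases h : G.Adj v u
      · have : subsetIndicator {u} S = 0 := if_neg fun hs =>
          hu (Finset.mem_erase.2 ⟨h.ne', Finset.singleton_subset_iff.1 hs⟩)
        rw [if_pos h, this, map_zero, zero_mul, zero_mul]
      · rw [if_neg h]
  rw [vertexRatio, hins, revSeries_insert G (Finset.notMem_erase v S), hsum, eq_comm,
    PowerSeries.eq_mul_inv_iff_mul_eq (hne _ _)]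
  ring

/-- In the recursion, the factor `X` raises the exponent by one and the indicator of `u` raises the
degree by one. -/
lemma coeffDegLE_vertexRatio {V : Type*} [LinearOrder V] [Fintype V] (j : ℕ) :
    ∀ (G : SimpleGraph V) (v : V), CoeffDegLE j (vertexRatio G v) := by
  classical
  induction j with
  | zero => exact fun G v i hi => absurd hi (Nat.not_lt_zero i)
  | succ j ih =>
    intro G v i hi
    simp only [vertexRatio_eq G v, map_sub]
    rcases i with _ | i
    · simp only [PowerSeries.coeff_zero_X_mul, sub_zero, PowerSeries.coeff_zero_one]
      exact one_mem_degLE 0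
    · simp only [PowerSeries.coeff_succ_X_mul, map_sum, PowerSeries.coeff_C_mul,
        PowerSeries.coeff_one, Nat.succ_ne_zero, if_false, zero_sub]
      refine Submodule.neg_mem _ (sum_mem_degLE _ fun u _ => ?_)
      rw [add_comm i 1]
      refine mul_mem_degLE (subsetIndicator_mem_degLE (by simp)) ?_
      have h := (ih (joinBelow G v u) u).mul
        ((ih G u).inv fun S => constantCoeff_vertexRatio G u S)
      exact erase_mem_degLE (h i (by omega)) v

/-- The sum of the `k`-th powers of the chromatic roots. -/
def powerSum {V : Type*} (G : SimpleGraph V) (k : ℕ) : ℂ :=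
  ((chromaticPolynomial G).roots.map (· ^ k)).sum

/-- Newton's identities: the reversed product is `∏ (1 - a X)`, with logarithmic derivative `-∑ a /
(1 - a X)`. -/
lemma derivative_reverse_prod (s : Multiset ℂ) :
    PowerSeries.derivative ℂ (((s.map fun a => X - C a).prod.reverse : ℂ[X]) : PowerSeries ℂ) =
      -((((s.map fun a => X - C a).prod.reverse : ℂ[X]) : PowerSeries ℂ) *
        PowerSeries.mk fun k => (s.map (· ^ (k + 1))).sum) := by
  induction s using Multiset.induction_on with
  | empty =>
    have h0 : (PowerSeries.mk fun _ : ℕ => (0 : ℂ)) = 0 := by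
      ext
      simp
    have h1 : (1 : ℂ[X]).reverse = 1 := by simpa using reverse_C (1 : ℂ)
    simp [h1, h0]
  | cons a s ih =>
    have hrev : (X - C a : ℂ[X]).reverse = 1 - C a * X := by
      rw [reverse, natDegree_X_sub_C, reflect_sub, reflect_one_X, reflect_C, pow_one]
    have hgeo : ((1 - C a * X : ℂ[X]) : PowerSeries ℂ) *
        (PowerSeries.mk fun k => a ^ (k + 1)) = PowerSeries.C a := by
      ext i
      rw [Polynomial.coe_sub, Polynomial.coe_mul, Polynomial.coe_one, Polynomial.coe_C,
        Polynomial.coe_X, sub_mul, one_mul, mul_assoc, map_sub, PowerSeries.coeff_C_mul]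
      rcases i with _ | i
      · simp
      · simp [PowerSeries.coeff_succ_X_mul]
        ring
    have hder : PowerSeries.derivative ℂ ((1 - C a * X : ℂ[X]) : PowerSeries ℂ) =
        -PowerSeries.C a := by
      rw [PowerSeries.derivative_coe]
      simp
    have hmk : (PowerSeries.mk fun k => ((a ::ₘ s).map (· ^ (k + 1))).sum) =
        (PowerSeries.mk fun k => a ^ (k + 1)) +
          PowerSeries.mk fun k => (s.map (· ^ (k + 1))).sum := by
      ext i
      simp
    rw [Multiset.map_cons, Multiset.prod_cons, reverse_mul_of_domain, Polynomial.coe_mul,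
      Derivation.leibniz, ih, hmk, hrev, hder, smul_eq_mul, smul_eq_mul, ← hgeo]
    ring

lemma derivative_revSeries {V : Type*} [Fintype V] (G : SimpleGraph V) (S : Finset V) :
    PowerSeries.derivative ℂ (revSeries G S) =
      -(revSeries G S * PowerSeries.mk fun k => powerSum (restrict G S) (k + 1)) := by
  have h := (IsAlgClosed.splits (chromaticPolynomial (restrict G S))).eq_prod_roots_of_monic
    (chromaticPolynomial_monic _)
  have := derivative_reverse_prod (chromaticPolynomial (restrict G S)).roots
  rw [← h] at this
  exact this

lemma powerSum_insert_sub_erase_mem_degLE {V : Type*} [LinearOrder V] [Fintype V]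
    (G : SimpleGraph V) (v : V) (k : ℕ) :
    (fun S => powerSum (restrict G (insert v S)) (k + 1) -
      powerSum (restrict G (S.erase v)) (k + 1)) ∈ degLE V (k + 1) := by
  set L : Finset V → PowerSeries ℂ :=
    fun S => PowerSeries.mk fun k => powerSum (restrict G S) (k + 1) with hL
  have hne : ∀ S, revSeries G S ≠ 0 := fun S h => by
    have := constantCoeff_revSeries G S
    rw [h, map_zero] at this
    exact zero_ne_one this
  have hlog : ∀ S, L (insert v S) - L (S.erase v) =
      -(PowerSeries.derivative ℂ (vertexRatio G v S) * (vertexRatio G v S)⁻¹) := by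
    intro S
    have h1 := congrArg (PowerSeries.derivative ℂ) (vertexRatio_mul G v S)
    rw [Derivation.leibniz, derivative_revSeries, derivative_revSeries, smul_eq_mul, smul_eq_mul,
      ← vertexRatio_mul G v S] at h1
    have h2 : revSeries G (S.erase v) * (-(L (insert v S) - L (S.erase v)) * vertexRatio G v S) =
        revSeries G (S.erase v) * PowerSeries.derivative ℂ (vertexRatio G v S) := by
      linear_combination -h1
    have h3 := mul_left_cancel₀ (hne _) h2
    rw [← PowerSeries.eq_mul_inv_iff_mul_eq (by
      rw [constantCoeff_vertexRatio]
      exact one_ne_zero)] at h3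
    rw [← h3, neg_neg]
  have hcoeff : (fun S => powerSum (restrict G (insert v S)) (k + 1) -
      powerSum (restrict G (S.erase v)) (k + 1)) = -fun S => ∑ x ∈ Finset.HasAntidiagonal.antidiagonal k,
        PowerSeries.coeff x.1 (PowerSeries.derivative ℂ (vertexRatio G v S)) *
          PowerSeries.coeff x.2 (vertexRatio G v S)⁻¹ := by
    funext S
    have h := congrArg (PowerSeries.coeff k) (hlog S)
    simp only [hL, map_sub, map_neg, PowerSeries.coeff_mk, PowerSeries.coeff_mul] at h
    exact h
  rw [hcoeff]
  refine Submodule.neg_mem _ (sum_mem_degLE _ fun x hx => ?_)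
  have hx := Finset.HasAntidiagonal.mem_antidiagonal.1 hx
  -- Differentiation shifts the index: coefficient `x.1` of the derivative has degree `x.1 + 1`.
  have hd : k + 1 = (x.1 + 1) + x.2 := by omega
  rw [hd]
  refine mul_mem_degLE ?_ (((coeffDegLE_vertexRatio (x.2 + 1) G v).inv
    fun S => constantCoeff_vertexRatio G v S) _ (Nat.lt_succ_self _))
  have h := Submodule.smul_mem _ ((x.1 : ℂ) + 1)
    (coeffDegLE_vertexRatio (x.1 + 2) G v (x.1 + 1) (by omega))
  convert h using 1
  funext S
  rw [PowerSeries.coeff_derivative, Pi.smul_apply, smul_eq_mul, mul_comm]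

/-- The power sum of exponent `k ≥ 1` is a set function of degree at most `k + 1` of the
vertex set. -/
lemma mobius_powerSum_eq_zero {V : Type*} [Fintype V] (G : SimpleGraph V) (k : ℕ)
    {T : Finset V} (hT : k + 2 < T.card) :
    mobius T (fun S => powerSum (restrict G S) (k + 1)) = 0 := by
  obtain ⟨o⟩ := exists_linearOrder V
  -- One point of `T` is spent on the difference in direction `v`, which has degree at most `k + 1`.
  obtain ⟨v, hv⟩ : T.Nonempty := Finset.card_pos.1 (by omega)
  rw [← Finset.insert_erase hv, mobius_insert (Finset.notMem_erase v T)]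
  refine mobius_eq_zero (powerSum_insert_sub_erase_mem_degLE G v k) ?_
  rw [Finset.card_erase_of_mem hv]
  omega

lemma powerSum_eq_sum_mobius {V : Type*} [Fintype V] (G : SimpleGraph V) (k : ℕ) :
    powerSum G (k + 1) = ∑ d ∈ Finset.range (k + 3), ∑ D ∈ Finset.powersetCard d Finset.univ,
      mobius D (fun S => powerSum (restrict G S) (k + 1)) := by
  classical
  have h := sum_mobius Finset.univ (fun S => powerSum (restrict G S) (k + 1))
  rw [restrict_univ] at h
  rw [← h, ← Finset.sum_filter_add_sum_filter_not _ (fun D : Finset V => D.card < k + 3)]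
  rw [Finset.sum_eq_zero (s := Finset.filter (fun D : Finset V => ¬ D.card < k + 3) _)
    (fun D hD => mobius_powerSum_eq_zero G k (by
      have := (Finset.mem_filter.1 hD).2
      omega)), add_zero]
  rw [← Finset.sum_fiberwise_of_maps_to (g := Finset.card) (t := Finset.range (k + 3))
    (fun D hD => Finset.mem_range.2 (Finset.mem_filter.1 hD).2)]
  refine Finset.sum_congr rfl fun d hd => Finset.sum_congr ?_ fun _ _ => rfl
  ext D
  have := Finset.mem_range.1 hd
  simp only [Finset.mem_filter, Finset.mem_powerset, Finset.mem_powersetCard]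
  constructor
  · rintro ⟨⟨h1, -⟩, h2⟩
    exact ⟨h1, h2⟩
  · rintro ⟨h1, h2⟩
    exact ⟨⟨h1, by omega⟩, h2⟩

/-! ### From Möbius transforms to subgraph counts -/

lemma isProper_map_iff {W V : Type*} (e : W ↪ V) (H : SimpleGraph W) {q : ℕ} (φ : V → Fin q) :
    IsProper (H.map e) φ ↔ IsProper H (φ ∘ e) := by
  constructor
  · intro h a b hab
    exact h (e a) (e b) ((SimpleGraph.map_adj e H _ _).2 ⟨a, b, hab, rfl, rfl⟩)
  · intro h a b hab
    obtain ⟨c, d, hcd, rfl, rfl⟩ := (SimpleGraph.map_adj e H _ _).1 hab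
    exact h c d hcd

lemma exists_chromaticPolynomial_map {W V : Type*} [Fintype W] [Fintype V] (e : W ↪ V)
    (H : SimpleGraph W) :
    ∃ m : ℕ, chromaticPolynomial (H.map e) = X ^ m * chromaticPolynomial H := by
  classical
  refine ⟨Fintype.card ((Set.range e)ᶜ : Set V), polynomial_eq_of_eval_nat fun q _ => ?_⟩
  let E : (V → Fin q) ≃ (W → Fin q) × (((Set.range e)ᶜ : Set V) → Fin q) :=
    (((Equiv.sumCongr (Equiv.ofInjective e e.injective) (Equiv.refl _)).trans
      (Equiv.Set.sumCompl (Set.range e))).symm.arrowCongr (Equiv.refl _)).trans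
      (Equiv.sumArrowEquivProdArrow _ _ _)
  have hE : ∀ φ, IsProper (H.map e) φ ↔ IsProper H (E φ).1 := fun φ => isProper_map_iff e H φ
  have h := Nat.card_congr ((Equiv.subtypeEquiv E (q := fun x => IsProper H x.1) hE).trans
    Equiv.prodSubtypeFstEquivSubtypeProd)
  rw [Nat.card_prod] at h
  rw [eval_mul, eval_pow, eval_X, eval_chromaticPolynomial, eval_chromaticPolynomial, colorCount,
    h, colorCount, Nat.cast_mul, mul_comm]
  simp

/-- Isolated vertices only add roots 0, invisible to positive powers. Hence Möbius terms depend only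
on induced subgraphs. -/
lemma powerSum_map {W V : Type*} [Fintype W] [Fintype V] (e : W ↪ V) (H : SimpleGraph W)
    (k : ℕ) : powerSum (H.map e) (k + 1) = powerSum H (k + 1) := by
  obtain ⟨m, hm⟩ := exists_chromaticPolynomial_map e H
  rw [powerSum, powerSum, hm, roots_mul (mul_ne_zero (pow_ne_zero _ X_ne_zero)
    (chromaticPolynomial_monic H).ne_zero), roots_X_pow, Multiset.map_add, Multiset.sum_add,
    Multiset.map_nsmul, Multiset.sum_nsmul]
  simp

lemma restrict_map {W V : Type*} (e : W ↪ V) (G : SimpleGraph V) (S : Finset W) :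
    restrict G (S.map e) = (restrict (G.comap e) S).map e := by
  ext a b
  rw [SimpleGraph.map_adj]
  constructor
  · rintro ⟨hab, ha, hb⟩
    obtain ⟨c, hc, rfl⟩ := Finset.mem_map.1 ha
    obtain ⟨d, hd, rfl⟩ := Finset.mem_map.1 hb
    exact ⟨c, d, ⟨hab, hc, hd⟩, rfl, rfl⟩
  · rintro ⟨a, b, ⟨hab, ha, hb⟩, rfl, rfl⟩
    exact ⟨hab, Finset.mem_map_of_mem e ha, Finset.mem_map_of_mem e hb⟩

lemma mobius_map {W V : Type*} (e : W ↪ V) (T : Finset W) (f : Finset V → ℂ) :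
    mobius (T.map e) f = mobius T fun S => f (S.map e) := by
  symm
  rw [mobius, mobius]
  refine Finset.sum_bij (fun S _ => S.map e) ?_ ?_ ?_ ?_
  · intro S hS
    exact Finset.mem_powerset.2 (Finset.map_subset_map.2 (Finset.mem_powerset.1 hS))
  · intro S _ S' _ h
    exact Finset.map_injective e h
  · intro S hS
    obtain ⟨S', hS', rfl⟩ := Finset.subset_map_iff.1 (Finset.mem_powerset.1 hS)
    exact ⟨S', Finset.mem_powerset.2 hS', rfl⟩
  · intro S _
    simp

/-- The contribution of a graph on exactly `d` vertices to the power sum of exponent `k + 1`. -/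
def localPowerSum (k : ℕ) {d : ℕ} (H : SimpleGraph (Fin d)) : ℂ :=
  mobius Finset.univ fun S => powerSum (restrict H S) (k + 1)

lemma mobius_map_univ_powerSum {V : Type*} [Fintype V] (G : SimpleGraph V) (k : ℕ) {d : ℕ}
    (e : Fin d ↪ V) :
    mobius (Finset.univ.map e) (fun S => powerSum (restrict G S) (k + 1)) =
      localPowerSum k (G.comap e) := by
  rw [mobius_map, localPowerSum]
  congr 1
  funext S
  rw [restrict_map, powerSum_map]

open Classical in
lemma card_embeddings_map_univ_eq {V : Type*} [Fintype V] {d : ℕ} {D : Finset V}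
    (hD : D.card = d) :
    (Finset.univ.filter fun e : Fin d ↪ V => Finset.univ.map e = D).card = d.factorial := by
  have hcard : Fintype.card (Fin d) = Fintype.card D := by simp [hD]
  let e₀ : Fin d ≃ D := Fintype.equivOfCardEq hcard
  have h : (Finset.univ : Finset (Equiv.Perm (Fin d))).card = d.factorial := by
    rw [Finset.card_univ, Fintype.card_perm, Fintype.card_fin]
  rw [← h]
  symm
  refine Finset.card_bij
    (fun σ _ => (σ.toEmbedding.trans e₀.toEmbedding).trans (Function.Embedding.subtype _))
    ?_ ?_ ?_
  · intro σ _
    refine Finset.mem_filter.2 ⟨Finset.mem_univ _, ?_⟩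
    ext a
    simp only [Finset.mem_map, Finset.mem_univ, true_and]
    constructor
    · rintro ⟨i, rfl⟩
      exact (e₀ (σ i)).2
    · intro ha
      exact ⟨σ.symm (e₀.symm ⟨a, ha⟩), by simp⟩
  · intro σ _ τ _ hστ
    ext i
    have := DFunLike.congr_fun hστ i
    exact congrArg Fin.val (by simpa using this)
  · intro e he
    have he := (Finset.mem_filter.1 he).2
    have hmem : ∀ i, e i ∈ D := fun i => he ▸ Finset.mem_map_of_mem e (Finset.mem_univ i)
    have hinj : Function.Injective fun i => e₀.symm ⟨e i, hmem i⟩ := by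
      intro i j hij
      simpa using hij
    refine ⟨Equiv.ofBijective _ (Finite.injective_iff_bijective.1 hinj), Finset.mem_univ _, ?_⟩
    ext i
    simp

lemma sum_embedding_eq {V : Type*} [Fintype V] (d : ℕ) [Fintype (Fin d ↪ V)]
    (g : Finset V → ℂ) :
    ∑ e : Fin d ↪ V, g (Finset.univ.map e) =
      d.factorial * ∑ D ∈ Finset.powersetCard d Finset.univ, g D := by
  classical
  have hmaps : ∀ e ∈ (Finset.univ : Finset (Fin d ↪ V)),
      Finset.univ.map e ∈ Finset.powersetCard d (Finset.univ : Finset V) := fun e _ =>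
    Finset.mem_powersetCard.2 ⟨Finset.subset_univ _, by simp⟩
  rw [← Finset.sum_fiberwise_of_maps_to hmaps, Finset.mul_sum]
  refine Finset.sum_congr rfl fun D hD => ?_
  rw [Finset.sum_congr rfl fun e he => by rw [(Finset.mem_filter.1 he).2], Finset.sum_const,
    nsmul_eq_mul]
  congr 2
  convert card_embeddings_map_univ_eq (Finset.mem_powersetCard.1 hD).2

/-- The number of injective maps `Fin d → V` along which `G` pulls back to `H`. -/
def embCount {V : Type*} (G : SimpleGraph V) {d : ℕ} (H : SimpleGraph (Fin d)) : ℕ :=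
  Nat.card {e : Fin d ↪ V // G.comap e = H}

/-- The number of maps `Fin d → V` along which `G` pulls back to `H`. -/
def pullbackCount {V : Type*} (G : SimpleGraph V) {d : ℕ} (H : SimpleGraph (Fin d)) : ℕ :=
  Nat.card {f : Fin d → V // G.comap f = H}

lemma sum_mobius_powersetCard {V : Type*} [Fintype V] (G : SimpleGraph V) (k d : ℕ)
    [Fintype (SimpleGraph (Fin d))] :
    ∑ D ∈ Finset.powersetCard d Finset.univ,
      mobius D (fun S => powerSum (restrict G S) (k + 1)) =
    (d.factorial : ℂ)⁻¹ * ∑ H : SimpleGraph (Fin d), localPowerSum k H * embCount G H := by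
  classical
  rw [eq_inv_mul_iff_mul_eq₀ (by exact_mod_cast d.factorial_ne_zero), ← sum_embedding_eq]
  simp only [mobius_map_univ_powerSum]
  rw [← Finset.sum_fiberwise_of_maps_to (g := fun e : Fin d ↪ V => G.comap e)
    (fun e _ => Finset.mem_univ _)]
  refine Finset.sum_congr rfl fun H _ => ?_
  rw [Finset.sum_congr rfl fun e he => by rw [(Finset.mem_filter.1 he).2], Finset.sum_const,
    nsmul_eq_mul, mul_comm, embCount, Nat.card_eq_fintype_card, Fintype.card_subtype]

/-- A map is a homomorphism exactly when the pullback of `G` contains `F`; this gives a triangular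
system for the pullback counts. -/
lemma homCount_eq_sum {V : Type*} [Fintype V] (G : SimpleGraph V) {d : ℕ}
    (F : SimpleGraph (Fin d)) [Fintype (SimpleGraph (Fin d))]
    [DecidablePred fun H : SimpleGraph (Fin d) => F ≤ H] :
    homCount F G = ∑ H with F ≤ H, pullbackCount G H := by
  classical
  have e : (F →g G) ≃ {f : Fin d → V // F ≤ G.comap f} :=
    { toFun := fun f => ⟨f, fun _ _ h => f.map_adj h⟩
      invFun := fun f => ⟨f.1, fun h => f.2 h⟩
      left_inv := fun _ => rfl
      right_inv := fun _ => rfl }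
  rw [homCount, Nat.card_congr e, Nat.card_eq_fintype_card, Fintype.card_subtype,
    Finset.card_eq_sum_card_fiberwise (f := fun f : Fin d → V => G.comap f)
      (t := Finset.univ.filter fun H => F ≤ H) (fun f hf => by simpa using hf)]
  refine Finset.sum_congr rfl fun H hH => ?_
  rw [pullbackCount, Nat.card_eq_fintype_card, Fintype.card_subtype, Finset.filter_filter]
  congr 1
  ext f
  simp only [Finset.mem_filter, Finset.mem_univ, true_and, and_iff_right_iff_imp]
  rintro rfl
  exact (Finset.mem_filter.1 hH).2

lemma embCount_le_pullbackCount {V : Type*} [Finite V] (G : SimpleGraph V) {d : ℕ}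
    (H : SimpleGraph (Fin d)) : embCount G H ≤ pullbackCount G H :=
  Nat.card_le_card_of_injective
    (fun e : {e : Fin d ↪ V // G.comap e = H} =>
      (⟨e.1, e.2⟩ : {f : Fin d → V // G.comap f = H}))
    fun _ _ h => Subtype.ext (DFunLike.coe_injective (congrArg Subtype.val h))

lemma pullbackCount_sub_embCount_le {V : Type*} [Fintype V] (G : SimpleGraph V) {d : ℕ}
    (H : SimpleGraph (Fin d)) :
    (pullbackCount G H : ℝ) - embCount G H ≤
      (Fintype.card V : ℝ) ^ d - (Fintype.card V).descFactorial d := by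
  classical
  have hpull : ∑ H : SimpleGraph (Fin d), pullbackCount G H = Fintype.card V ^ d := by
    rw [← Fintype.card_pi_const, ← Finset.card_univ,
      Finset.card_eq_sum_card_fiberwise (f := fun f : Fin d → V => G.comap f)
        (t := Finset.univ) (fun f _ => Finset.mem_coe.2 (Finset.mem_univ _))]
    refine Finset.sum_congr rfl fun H _ => ?_
    rw [pullbackCount, Nat.card_eq_fintype_card, Fintype.card_subtype]
  have hemb : ∑ H : SimpleGraph (Fin d), embCount G H = (Fintype.card V).descFactorial d := by
    have hcard := Fintype.card_embedding_eq (α := Fin d) (β := V)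
    rw [Fintype.card_fin] at hcard
    rw [← hcard, ← Finset.card_univ,
      Finset.card_eq_sum_card_fiberwise (f := fun f : Fin d ↪ V => G.comap f)
        (t := Finset.univ) (fun f _ => Finset.mem_coe.2 (Finset.mem_univ _))]
    refine Finset.sum_congr rfl fun H _ => ?_
    rw [embCount, Nat.card_eq_fintype_card, Fintype.card_subtype]
  have hle := Finset.single_le_sum (f := fun H : SimpleGraph (Fin d) =>
    (pullbackCount G H : ℝ) - embCount G H) (fun H _ => sub_nonneg.2
      (Nat.cast_le.2 (embCount_le_pullbackCount G H))) (Finset.mem_univ H)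
  rw [Finset.sum_sub_distrib] at hle
  refine hle.trans_eq ?_
  rw [← hemb, ← Nat.cast_pow, ← hpull]
  push_cast
  rfl

/-! ### Convergence of the counts and moments -/

section Limits

variable {V : ℕ → Type*} [∀ n, Fintype (V n)] {G : ∀ n, SimpleGraph (V n)}

/-- Solve the triangular system downwards, from the complete graph: subtract the strict supergraphs
of `H`. -/
lemma exists_tendsto_pullbackCount (hG : DenseConvergent G) {d : ℕ} (H : SimpleGraph (Fin d)) :
    ∃ t : ℝ, Tendsto (fun n => (pullbackCount (G n) H : ℝ) / (Fintype.card (V n) : ℝ) ^ d)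
      atTop (𝓝 t) := by
  classical
  induction H using WellFoundedGT.induction with
  | ind H ih =>
    choose! t ht using ih
    obtain ⟨s, hs⟩ := hG d H
    refine ⟨s - ∑ H' with H < H', t H', ?_⟩
    refine (hs.sub (tendsto_finsetSum _ fun H' hH' =>
      ht H' (Finset.mem_filter.1 hH').2)).congr fun n => ?_
    have hfil : (Finset.univ.filter fun H' => H ≤ H') =
        insert H (Finset.univ.filter fun H' => H < H') := by
      ext H'
      simp [le_iff_eq_or_lt, eq_comm]
    rw [homCount_eq_sum, hfil, Finset.sum_insert (by simp), Nat.card_eq_fintype_card,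
      ← Finset.sum_div, ← sub_div]
    push_cast
    ring

/-- Non-injective maps are a vanishing fraction of all `n ^ d` maps. -/
lemma exists_tendsto_embCount (hV : Tendsto (fun n => Fintype.card (V n)) atTop atTop)
    (hG : DenseConvergent G) {d : ℕ} (H : SimpleGraph (Fin d)) :
    ∃ t : ℝ, Tendsto (fun n => (embCount (G n) H : ℝ) / (Fintype.card (V n) : ℝ) ^ d)
      atTop (𝓝 t) := by
  obtain ⟨t, ht⟩ := exists_tendsto_pullbackCount hG H
  refine ⟨t, ?_⟩
  have hdesc : Tendsto (fun n : ℕ => ((n : ℝ) ^ d - n.descFactorial d) / (n : ℝ) ^ d) atTop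
      (𝓝 0) := by
    have h1 : Tendsto (fun n : ℕ => (n.descFactorial d : ℝ) / (n : ℝ) ^ d) atTop (𝓝 1) := by
      refine (Asymptotics.isEquivalent_iff_tendsto_one ?_).1 (isEquivalent_descFactorial d)
      filter_upwards [eventually_gt_atTop 0] with n hn
      positivity
    have h2 := (tendsto_const_nhds (x := (1 : ℝ))).sub h1
    rw [sub_self] at h2
    refine h2.congr' ?_
    filter_upwards [eventually_gt_atTop 0] with n hn
    rw [sub_div, div_self (by positivity)]
  have hdiff : Tendsto (fun n => (pullbackCount (G n) H : ℝ) / (Fintype.card (V n) : ℝ) ^ d -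
      (embCount (G n) H : ℝ) / (Fintype.card (V n) : ℝ) ^ d) atTop (𝓝 0) := by
    refine squeeze_zero (fun n => ?_) (fun n => ?_) (hdesc.comp hV)
    · rw [← sub_div]
      exact div_nonneg (sub_nonneg.2 (Nat.cast_le.2 (embCount_le_pullbackCount _ _)))
        (by positivity)
    · rw [← sub_div]
      exact div_le_div_of_nonneg_right (pullbackCount_sub_embCount_le (G n) H) (by positivity)
  have h := ht.sub hdiff
  rw [sub_zero] at h
  exact h.congr fun n => by ring

lemma exists_tendsto_div_pow (hV : Tendsto (fun n => Fintype.card (V n)) atTop atTop)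
    {a : ℕ → ℝ} {d m : ℕ} (hdm : d ≤ m)
    (ha : ∃ t : ℝ, Tendsto (fun n => a n / (Fintype.card (V n) : ℝ) ^ d) atTop (𝓝 t)) :
    ∃ t : ℝ, Tendsto (fun n => a n / (Fintype.card (V n) : ℝ) ^ m) atTop (𝓝 t) := by
  rcases hdm.eq_or_lt with rfl | hlt
  · exact ha
  · obtain ⟨t, ht⟩ := ha
    have hinv : Tendsto (fun n => ((Fintype.card (V n) : ℝ) ^ (m - d))⁻¹) atTop (𝓝 0) :=
      tendsto_inv_atTop_zero.comp ((tendsto_pow_atTop (by omega)).comp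
        (tendsto_natCast_atTop_atTop.comp hV))
    refine ⟨t * 0, (ht.mul hinv).congr fun n => ?_⟩
    rw [← div_eq_mul_inv, div_div, ← pow_add, Nat.add_sub_cancel' hdm]

lemma exists_tendsto_powerSum (hV : Tendsto (fun n => Fintype.card (V n)) atTop atTop)
    (hG : DenseConvergent G) (k : ℕ) :
    ∃ t : ℂ, Tendsto (fun n => powerSum (G n) k / (Fintype.card (V n) : ℂ) ^ (k + 1))
      atTop (𝓝 t) := by
  classical
  rcases k with _ | k
  -- Exponent 0 is separate, since there roots 0 do count; the moment is 1 once the graph is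
  -- non-empty.
  · refine ⟨1, tendsto_const_nhds.congr' ?_⟩
    filter_upwards [hV.eventually_gt_atTop 0] with n hn
    have hn' : (Fintype.card (V n) : ℂ) ≠ 0 := by exact_mod_cast hn.ne'
    simp [powerSum, card_roots_chromaticPolynomial, div_self hn']
  · have h : ∀ d ∈ Finset.range (k + 3), ∀ H : SimpleGraph (Fin d), ∃ t : ℝ,
        Tendsto (fun n => (embCount (G n) H : ℝ) / (Fintype.card (V n) : ℝ) ^ (k + 2))
          atTop (𝓝 t) := fun d hd H =>
      exists_tendsto_div_pow hV (by
        have := Finset.mem_range.1 hd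
        omega) (exists_tendsto_embCount hV hG H)
    choose! t ht using h
    refine ⟨∑ d ∈ Finset.range (k + 3), (d.factorial : ℂ)⁻¹ *
      ∑ H : SimpleGraph (Fin d), localPowerSum k H * (t d H : ℂ), ?_⟩
    refine (tendsto_finsetSum _ fun d hd => (tendsto_finsetSum _ fun H _ =>
      ((Complex.continuous_ofReal.tendsto _).comp (ht d hd H)).const_mul
        (localPowerSum k H)).const_mul ((d.factorial : ℂ)⁻¹)).congr fun n => ?_
    rw [powerSum_eq_sum_mobius, Finset.sum_div]
    refine Finset.sum_congr rfl fun d _ => ?_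
    rw [sum_mobius_powersetCard, mul_div_assoc, Finset.sum_div]
    congr 1
    refine Finset.sum_congr rfl fun H _ => ?_
    simp [mul_div_assoc]

end Limits

/-! ### Integration against the rescaled chromatic measure -/

lemma integrable_sum_dirac (f : ℂ → ℂ) (s : Multiset ℂ) :
    Integrable f (s.map Measure.dirac).sum ∧
      ∫ z, f z ∂(s.map Measure.dirac).sum = (s.map f).sum := by
  induction s using Multiset.induction_on with
  | empty => simp
  | cons a s ih =>
    have ha : Integrable f (Measure.dirac a) := integrable_dirac enorm_lt_top
    rw [Multiset.map_cons, Multiset.sum_cons, Multiset.map_cons, Multiset.sum_cons]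
    exact ⟨ha.add_measure ih.1, by rw [integral_add_measure ha ih.1, integral_dirac, ih.2]⟩

lemma ae_sum_dirac {p : ℂ → Prop} (s : Multiset ℂ) (h : ∀ z ∈ s, p z) :
    ∀ᵐ z ∂(s.map Measure.dirac).sum, p z := by
  induction s using Multiset.induction_on with
  | empty => simp
  | cons a s ih =>
    rw [Multiset.map_cons, Multiset.sum_cons, ae_add_measure_iff, ae_dirac_eq]
    exact ⟨h a (Multiset.mem_cons_self a s), ih fun z hz => h z (Multiset.mem_cons_of_mem hz)⟩

lemma map_sum_dirac (g : ℂ → ℂ) (hg : Measurable g) (s : Multiset ℂ) :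
    (s.map Measure.dirac).sum.map g = ((s.map g).map Measure.dirac).sum := by
  induction s using Multiset.induction_on with
  | empty => simp
  | cons a s ih =>
    rw [Multiset.map_cons, Multiset.sum_cons, Measure.map_add _ _ hg, ih, Measure.map_dirac]
    simp

lemma scaledChromaticMeasure_eq {V : Type*} [Fintype V] (G : SimpleGraph V) :
    scaledChromaticMeasure G = ((Fintype.card V : ℕ) : ENNReal)⁻¹ •
      (((chromaticPolynomial G).roots.map (· / (Fintype.card V : ℂ))).map Measure.dirac).sum := by
  rw [scaledChromaticMeasure, chromaticMeasure, Measure.map_smul, map_sum_dirac _ (by fun_prop),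
    card_roots_chromaticPolynomial, Nat.card_eq_fintype_card]

lemma norm_div_card_lt {V : Type*} [Fintype V] (G : SimpleGraph V) {z : ℂ}
    (hz : z ∈ (chromaticPolynomial G).roots.map (· / (Fintype.card V : ℂ))) : ‖z‖ < 6 := by
  obtain ⟨w, hw, rfl⟩ := Multiset.mem_map.1 hz
  have h := norm_lt_of_mem_roots G hw
  have hpos : (0 : ℝ) < Fintype.card V := by
    linarith [norm_nonneg w]
  rw [norm_div, Complex.norm_natCast, div_lt_iff₀ hpos]
  exact h

lemma ae_scaledChromaticMeasure {V : Type*} [Fintype V] (G : SimpleGraph V) :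
    ∀ᵐ z ∂scaledChromaticMeasure G, ‖z‖ < 6 := by
  rw [scaledChromaticMeasure_eq]
  exact Measure.ae_smul_measure (ae_sum_dirac _ fun z hz => norm_div_card_lt G hz) _

lemma integrable_scaledChromaticMeasure {V : Type*} [Fintype V] (G : SimpleGraph V)
    (f : ℂ → ℂ) : Integrable f (scaledChromaticMeasure G) := by
  rcases isEmpty_or_nonempty V with h | h
  -- Here the scalar `0⁻¹` is infinite, but it multiplies the zero measure.
  · have h0 : (chromaticPolynomial G).roots = 0 := by
      rw [← Multiset.card_eq_zero, card_roots_chromaticPolynomial, Fintype.card_eq_zero]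
    rw [scaledChromaticMeasure_eq, h0]
    simp
  · rw [scaledChromaticMeasure_eq]
    exact (integrable_sum_dirac f _).1.smul_measure
      (ENNReal.inv_ne_top.2 (by exact_mod_cast Fintype.card_ne_zero))

lemma integral_scaledChromaticMeasure {V : Type*} [Fintype V] (G : SimpleGraph V) (f : ℂ → ℂ) :
    ∫ z, f z ∂scaledChromaticMeasure G = (Fintype.card V : ℂ)⁻¹ *
      (((chromaticPolynomial G).roots.map (· / (Fintype.card V : ℂ))).map f).sum := by
  rw [scaledChromaticMeasure_eq, integral_smul_measure, (integrable_sum_dirac f _).2]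
  simp

lemma integral_pow_scaledChromaticMeasure {V : Type*} [Fintype V] (G : SimpleGraph V) (k : ℕ) :
    ∫ z, z ^ k ∂scaledChromaticMeasure G =
      powerSum G k / (Fintype.card V : ℂ) ^ (k + 1) := by
  have h : ((chromaticPolynomial G).roots.map fun z => (z / (Fintype.card V : ℂ)) ^ k) =
      (chromaticPolynomial G).roots.map fun z => z ^ k * ((Fintype.card V : ℂ) ^ k)⁻¹ :=
    Multiset.map_congr rfl fun z _ => by rw [div_pow, div_eq_mul_inv]
  rw [integral_scaledChromaticMeasure, Multiset.map_map]
  simp only [Function.comp_def]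
  rw [h, Multiset.sum_map_mul_right, powerSum, div_eq_mul_inv, pow_succ, mul_inv]
  ring

lemma norm_integral_pow_le {V : Type*} [Fintype V] (G : SimpleGraph V) (k : ℕ) :
    ‖∫ z, z ^ k ∂scaledChromaticMeasure G‖ ≤ 6 ^ k := by
  set s := (chromaticPolynomial G).roots.map (· / (Fintype.card V : ℂ)) with hs
  rw [integral_scaledChromaticMeasure, norm_mul, norm_inv, Complex.norm_natCast]
  have hcard : s.card = Fintype.card V := by
    rw [hs, Multiset.card_map, card_roots_chromaticPolynomial]
  have hsum : ‖(s.map (· ^ k)).sum‖ ≤ Fintype.card V * 6 ^ k := by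
    refine (norm_multiset_sum_le _).trans ?_
    rw [Multiset.map_map]
    have h := Multiset.sum_le_card_nsmul (s.map (norm ∘ fun z : ℂ => z ^ k)) (6 ^ k) (by
      intro x hx
      obtain ⟨z, hz, rfl⟩ := Multiset.mem_map.1 hx
      simp only [Function.comp_apply, norm_pow]
      exact pow_le_pow_left₀ (norm_nonneg z) (norm_div_card_lt G hz).le k)
    rw [Multiset.card_map, hcard, nsmul_eq_mul] at h
    exact h
  rcases (Nat.cast_nonneg (α := ℝ) (Fintype.card V)).eq_or_lt with h0 | hpos
  · rw [← h0, inv_zero, zero_mul]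
    positivity
  · rw [inv_mul_le_iff₀ hpos]
    exact hsum

/-- The integral of a function holomorphic on a disk of radius greater than `6` is the sum of its
Taylor coefficients weighted by the moments. -/
lemma hasSum_integral {V : Type*} [Fintype V] (G : SimpleGraph V) {f : ℂ → ℂ} {a : ℕ → ℂ}
    (hf : ∀ z, ‖z‖ < 6 → HasSum (fun k => a k * z ^ k) (f z)) :
    HasSum (fun k => a k * ∫ z, z ^ k ∂scaledChromaticMeasure G)
      (∫ z, f z ∂scaledChromaticMeasure G) := by
  simp only [integral_scaledChromaticMeasure]
  have hmul : ∀ s : Multiset ℂ, (∀ z ∈ s, ‖z‖ < 6) →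
      HasSum (fun k => a k * (s.map (· ^ k)).sum) (s.map f).sum := by
    intro s
    induction s using Multiset.induction_on with
    | empty =>
      intro _
      simp
    | cons z s ih =>
      intro h
      have h1 := (hf z (h z (Multiset.mem_cons_self z s))).add
        (ih fun w hw => h w (Multiset.mem_cons_of_mem hw))
      simpa [mul_add] using h1
  refine ((hmul _ fun z hz => norm_div_card_lt G hz).mul_left (Fintype.card V : ℂ)⁻¹).congr_fun ?_
  intro k
  ring

end ChromaticLimits

end

theorem mainTheorem1 {V : ℕ → Type*} [∀ n, Finite (V n)] (G : ∀ n, SimpleGraph (V n))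
    (hV : Tendsto (fun n => Nat.card (V n)) atTop atTop)
    (hG : ChromaticLimits.DenseConvergent G)
    (f : ℂ → ℂ) (hf : DifferentiableOn ℂ f (Metric.ball 0 8)) :
    (∀ n, (∀ᵐ z ∂(ChromaticLimits.scaledChromaticMeasure (G n)), z ∈ Metric.ball (0 : ℂ) 8) ∧
      Integrable f (ChromaticLimits.scaledChromaticMeasure (G n))) ∧
    ∃ L : ℂ, Tendsto (fun n => ∫ z, f z ∂(ChromaticLimits.scaledChromaticMeasure (G n)))
      atTop (𝓝 L) := by
  have : ∀ n, Fintype (V n) := fun n => Fintype.ofFinite (V n)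
  refine ⟨fun n => ⟨?_, ChromaticLimits.integrable_scaledChromaticMeasure (G n) f⟩, ?_⟩
  · filter_upwards [ChromaticLimits.ae_scaledChromaticMeasure (G n)] with z hz
    rw [mem_ball_zero_iff]
    linarith
  · simp only [Nat.card_eq_fintype_card] at hV
    set a : ℕ → ℂ := fun k => (k.factorial : ℂ)⁻¹ * iteratedDeriv k f 0 with ha
    have hsum : ∀ z ∈ Metric.ball (0 : ℂ) 8, HasSum (fun k => a k * z ^ k) (f z) := by
      intro z hz
      have h := Complex.hasSum_taylorSeries_on_ball hf hz
      refine h.congr_fun fun k => ?_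
      simp only [ha, smul_eq_mul, sub_zero]
      ring
    -- The Taylor series converges absolutely at `6 < 8`, which dominates all moment series
    -- uniformly in `n`.
    have hbound : Summable fun k => ‖a k‖ * 6 ^ k := by
      have h := (hsum 6 (by rw [mem_ball_zero_iff]; norm_num)).summable.norm
      simpa using h
    have hint : ∀ n, HasSum
        (fun k => a k * ∫ z, z ^ k ∂ChromaticLimits.scaledChromaticMeasure (G n))
        (∫ z, f z ∂ChromaticLimits.scaledChromaticMeasure (G n)) := fun n =>
      ChromaticLimits.hasSum_integral (G n) fun z hz => hsum z (by
        rw [mem_ball_zero_iff]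
        linarith)
    choose t ht using fun k => ChromaticLimits.exists_tendsto_powerSum hV hG k
    refine ⟨∑' k, a k * t k, ?_⟩
    simp only [← fun n => (hint n).tsum_eq]
    refine tendsto_tsum_of_dominated_convergence hbound (fun k => ?_)
      (Eventually.of_forall fun n k => ?_)
    · simp only [ChromaticLimits.integral_pow_scaledChromaticMeasure]
      exact (ht k).const_mul (a k)
    · rw [norm_mul]
      exact mul_le_mul_of_nonneg_left (ChromaticLimits.norm_integral_pow_le (G n) k)
        (norm_nonneg _)
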